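/- Let $G$ be a Hausdorff topological group with identity $e$. A partial action $\theta$ of $G$ on a set $X$ is a map $\theta: G*X\to X$, $(g,x)\mapsto g\cdot x$, defined on a subset $G*X\subseteq G\times X$ (write $\exists\, g\cdot x$ for $(g,x)\in G*X$), such that for all $g,h\in G$ and $x\in X$: (i) if $\exists\, g\cdot x$, then $\exists\, g^{-1}\cdot(g\cdot x)$ and $g^{-1}\cdot(g\cdot x)=x$; (ii) if $\exists\, g\cdot(h\cdot x)$, then $\exists\,(gh)\cdot x$ and $g\cdot(h\cdot x)=(gh)\cdot x$; (iii) $\exists\, e\cdot x$ and $e\cdot x=x$. If $X$ is a topological space, $\theta$ is called nice if $G*X$ is open in $G\times X$ (with the product topology) and $\theta: G*X\to X$ is continuous. The enveloping space $X_G$ of $(X,\theta)$ is the quotient space $(G\times X)/R$ with the quotient topology, where $(g,x)\,R\,(h,y)$ if and only if $\exists\,(h^{-1}g)\cdot x$ and $(h^{-1}g)\cdot x=y$. A metrizable space $Z$ is an ANE (absolute neighborhood extensor) if for every metrizable space $Y$ and every closed subset $A\subseteq Y$, every continuous map $f:A\to Z$ extends to a continuous map $F:U\to Z$ for some neighborhood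 $U$ of $A$ in $Y$. Proposition. Let $X$ be a metrizable separable space with a nice partial action $\theta$ of $G$, and suppose that the enveloping space $X_G$ is metrizable. Then $X$ is an ANE if and only if $X_G$ is an ANE. -/

import Mathlib

open TopologicalSpace

universe u v w

/-- A (set-theoretic) partial action of a group `G` on a set `X`: a map `act` defined on a subset
`dom` of `G × X` (written `G * X`; `(g, x) ∈ dom` means that `g · x` exists), such that
* if `g · x` exists, then `g⁻¹ · (g · x)` exists and equals `x`;
* if `g · (h · x)` exists, then `(g h) · x` exists and equals `g · (h · x)`;
* `1 · x` exists and equals `x`. -/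
structure PartialAction (G : Type u) (X : Type v) [Group G] where
  dom : Set (G × X)
  act : dom → X
  inv_act : ∀ (g : G) (x : X) (h : (g, x) ∈ dom),
    ∃ h' : (g⁻¹, act ⟨(g, x), h⟩) ∈ dom, act ⟨(g⁻¹, act ⟨(g, x), h⟩), h'⟩ = x
  act_act : ∀ (g h : G) (x : X) (hx : (h, x) ∈ dom) (hg : (g, act ⟨(h, x), hx⟩) ∈ dom),
    ∃ hgh : (g * h, x) ∈ dom, act ⟨(g, act ⟨(h, x), hx⟩), hg⟩ = act ⟨(g * h, x), hgh⟩
  one_act : ∀ x : X, ∃ h : ((1 : G), x) ∈ dom, act ⟨(1, x), h⟩ = x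

namespace PartialAction

variable {G : Type u} {X : Type v} [Group G]

/-- A partial action is nice if it is continuous on `G * X` and `G * X` is open in `G × X`.
Then every `X_g = {x | g⁻¹ · x exists}` is open in `X`, and `x ↦ g · x` is a homeomorphism of
`X_{g⁻¹}` onto `X_g`. -/
structure IsNice [TopologicalSpace G] [TopologicalSpace X] (θ : PartialAction G X) : Prop where
  continuous_act : Continuous θ.act
  isOpen_dom : IsOpen θ.dom

/-- The relation `(g, x) R (h, y)`: `(h⁻¹ g) · x` exists (that is, `x ∈ X_{g⁻¹ h}`) and equals
`y`. -/
def Rel (θ : PartialAction G X) (p q : G × X) : Prop :=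
  ∃ hx : (q.1⁻¹ * p.1, p.2) ∈ θ.dom, θ.act ⟨(q.1⁻¹ * p.1, p.2), hx⟩ = q.2

theorem rel_equivalence (θ : PartialAction G X) : Equivalence θ.Rel where
  refl := by
    rintro ⟨g, x⟩
    simp only [Rel, inv_mul_cancel]
    exact θ.one_act x
  symm := by
    rintro ⟨g, x⟩ ⟨h, y⟩ ⟨hx, hy⟩
    dsimp only at hx hy
    subst hy
    have e : g⁻¹ * h = (h⁻¹ * g)⁻¹ := by group
    simp only [Rel, e]
    exact θ.inv_act _ x hx
  trans := by
    rintro ⟨g, x⟩ ⟨h, y⟩ ⟨k, z⟩ ⟨hx, hy⟩ ⟨hx', hz⟩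
    dsimp only at hx hy hx' hz
    subst hy
    subst hz
    have e : k⁻¹ * g = (k⁻¹ * h) * (h⁻¹ * g) := by group
    simp only [Rel, e]
    obtain ⟨h1, h2⟩ := θ.act_act _ _ x hx hx'
    exact ⟨h1, h2.symm⟩

/-- The equivalence relation on `G × X` that defines the enveloping space. -/
def envelopingSetoid (θ : PartialAction G X) : Setoid (G × X) :=
  ⟨θ.Rel, θ.rel_equivalence⟩

/-- The enveloping space (globalization) `X_G = (G × X) / R`. -/
def EnvelopingSpace (θ : PartialAction G X) : Type (max u v) :=
  Quotient θ.envelopingSetoid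

/-- `X_G` carries the quotient topology of the product topology on `G × X`. -/
instance [TopologicalSpace G] [TopologicalSpace X] (θ : PartialAction G X) :
    TopologicalSpace θ.EnvelopingSpace :=
  inferInstanceAs (TopologicalSpace (Quotient θ.envelopingSetoid))

end PartialAction

/-- `X` is an absolute neighborhood extensor (for metrizable spaces): `X` is metrizable, and every
continuous map into `X` from a closed subset `A` of a metrizable space `Y` extends continuously to
some (open) neighborhood `U` of `A` in `Y`. The spaces `Y` range over an arbitrary universe. -/
def IsANE.{a, b} (X : Type b) [TopologicalSpace X] : Prop :=
  MetrizableSpace X ∧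
    ∀ (Y : Type a) [TopologicalSpace Y] [MetrizableSpace Y] (A : Set Y), IsClosed A →
      ∀ f : C(A, X), ∃ (U : Set Y) (_ : IsOpen U) (hAU : A ⊆ U) (F : C(U, X)),
        ∀ a : A, F ⟨a, hAU a.2⟩ = f a

/-!
For every `g : G` the map `x ↦ [(g, x)]` is an open embedding of `X` into the enveloping space
`X_G`: it is injective because `1` acts as the identity, and it is open because the set of pairs
`(h, y)` equivalent to some `(g, x)` with `x ∈ U` is the set where `(g⁻¹ h) · y` exists and lies in
`U`, which is open for a nice partial action. The images of these embeddings cover `X_G`. So the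
theorem reduces to two facts about ANEs.

* An open subspace of an ANE is an ANE (`IsANE.of_isOpenEmbedding`): shrink the neighborhood to
  the preimage of the open subspace.
* A metrizable space `Z` covered by open subspaces `W i` that are ANEs is an ANE
  (`isANE_of_isOpenEmbedding_cover`, a theorem of Hanner). Given `f` on a closed set `A ⊆ Y`,
  paracompactness of `Y` gives a locally finite closed family `B i`, whose union is a neighborhood
  of `A`, with `f (A ∩ B i) ⊆ W i`. The map is extended over a closed neighborhood of `A ∩ B i` in
  `B i`, one index `i` at a time (`PartialExtension.exists_insert`), while the condition that the
  current domain meets each `B j` in a set sent into `W j` is preserved; local finiteness makes this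
  possible for all `j` at once. Zorn's lemma completes the process: near each point a chain of such
  extensions is eventually constant, again by local finiteness
  (`PartialExtension.exists_upper_bound`).
-/

open Set Filter Topology

/-! ### Extensions of maps into open subspaces -/

theorem IsANE.of_isOpenEmbedding {X : Type*} {Z : Type*} [TopologicalSpace X] [TopologicalSpace Z]
    {e : X → Z} (he : IsOpenEmbedding e) (hZ : IsANE.{w} Z) : IsANE.{w} X := by
  obtain ⟨hm, hZ⟩ := hZ
  refine ⟨he.isEmbedding.metrizableSpace, fun Y _ _ A hA f => ?_⟩
  obtain ⟨U, hU, hAU, F, hF⟩ := hZ Y A hA ⟨fun a => e (f a), he.continuous.comp f.continuous⟩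
  have hopen : IsOpen (Subtype.val '' (F ⁻¹' range e)) :=
    hU.isOpenMap_subtype_val _ (he.isOpen_range.preimage F.continuous)
  have hU' : ∀ y : Subtype.val '' (F ⁻¹' range e), ∃ h : y.1 ∈ U, F ⟨y.1, h⟩ ∈ range e := by
    rintro ⟨_, y, hy, rfl⟩
    exact ⟨y.2, hy⟩
  choose hmem F' hF' using hU'
  refine ⟨_, hopen, fun a ha => ⟨⟨a, hAU ha⟩, ?_, rfl⟩, ⟨F', ?_⟩, fun a => he.injective ?_⟩
  · exact ⟨f ⟨a, ha⟩, (hF ⟨a, ha⟩).symm⟩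
  · rw [he.isInducing.continuous_iff]
    have : e ∘ F' = fun y => F ⟨y.1, hmem y⟩ := funext hF'
    rw [this]
    exact F.continuous.comp (continuous_subtype_val.subtype_mk _)
  · exact (hF' _).trans (hF a)

/-- The extension property of an ANE, for total functions that are continuous on a closed set and
send it into a copy of the ANE. -/
theorem IsANE.exists_continuousOn_extension {X : Type*} {Z : Type*} {Y : Type w}
    [TopologicalSpace X] [TopologicalSpace Z] [TopologicalSpace Y] [MetrizableSpace Y]
    (hX : IsANE.{w} X) {e : X → Z} (he : IsEmbedding e) {A : Set Y} (hA : IsClosed A) {f : Y → Z}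
    (hf : ContinuousOn f A) (hfe : MapsTo f A (range e)) :
    ∃ U : Set Y, IsOpen U ∧ A ⊆ U ∧ ∃ F : Y → Z, ContinuousOn F U ∧ EqOn F f A := by
  classical
  choose g hg using fun a : A => hfe a.2
  have hgc : Continuous g := by
    rw [he.isInducing.continuous_iff]
    have : e ∘ g = A.domRestrict f := funext hg
    rw [this]
    exact hf.domRestrict
  obtain ⟨U, hU, hAU, F, hF⟩ := hX.2 Y A hA ⟨g, hgc⟩
  refine ⟨U, hU, hAU, fun y => if h : y ∈ U then e (F ⟨y, h⟩) else f y, ?_, fun a ha => ?_⟩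
  · rw [continuousOn_iff_continuous_domRestrict]
    have : U.domRestrict (fun y => if h : y ∈ U then e (F ⟨y, h⟩) else f y) = e ∘ F := by
      funext y
      simp
    rw [this]
    exact he.continuous.comp F.continuous
  · have h1 := hF ⟨a, ha⟩
    have h2 := hg ⟨a, ha⟩
    simp only [hAU ha, dite_true, h1]
    exact h2

/-! ### Partial extensions over a locally finite closed family -/

/-- An extension of `f`, continuous on the closed set `A`, to a closed set `dom` that is a
neighborhood of `A ∩ B i` relative to `B i` for each `i ∈ idx`, and that still sends each part
`dom ∩ B i` into `W i`. The underlying function is total; its values off `dom` are irrelevant. -/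
structure PartialExtension {ι Y Z : Type*} [TopologicalSpace Y] [TopologicalSpace Z]
    (A : Set Y) (f : Y → Z) (B : ι → Set Y) (W : ι → Set Z) where
  idx : Set ι
  dom : Set Y
  toFun : Y → Z
  isClosed_dom : IsClosed dom
  subset_dom : A ⊆ dom
  eqOn : EqOn toFun f A
  continuousOn : ContinuousOn toFun dom
  mapsTo : ∀ i, MapsTo toFun (dom ∩ B i) (W i)
  mem_nhdsWithin : ∀ i ∈ idx, ∀ a ∈ A ∩ B i, dom ∈ 𝓝[B i] a

namespace PartialExtension

variable {ι Y Z : Type*} [TopologicalSpace Y] [TopologicalSpace Z]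
  {A : Set Y} {f : Y → Z} {B : ι → Set Y} {W : ι → Set Z}

/-- `q` extends `p`, and the points added to the domain lie in members `B i` of the family whose
index `i` is also new. The latter makes chains eventually constant near each point. -/
structure Extends (p q : PartialExtension A f B W) : Prop where
  idx_subset : p.idx ⊆ q.idx
  dom_subset : p.dom ⊆ q.dom
  eqOn : EqOn q.toFun p.toFun p.dom
  exists_mem : ∀ y ∈ q.dom, y ∉ p.dom → ∃ i ∈ q.idx, i ∉ p.idx ∧ y ∈ B i

theorem Extends.refl (p : PartialExtension A f B W) : p.Extends p :=
  ⟨Subset.rfl, Subset.rfl, fun _ _ => rfl, fun _ h h' => absurd h h'⟩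

theorem Extends.trans {p q r : PartialExtension A f B W} (hpq : p.Extends q) (hqr : q.Extends r) :
    p.Extends r where
  idx_subset := hpq.idx_subset.trans hqr.idx_subset
  dom_subset := hpq.dom_subset.trans hqr.dom_subset
  eqOn y hy := (hqr.eqOn (hpq.dom_subset hy)).trans (hpq.eqOn hy)
  exists_mem y hy hyp := by
    by_cases hyq : y ∈ q.dom
    · obtain ⟨i, hi, hip, hyi⟩ := hpq.exists_mem y hyq hyp
      exact ⟨i, hqr.idx_subset hi, hip, hyi⟩
    · obtain ⟨i, hi, hiq, hyi⟩ := hqr.exists_mem y hy hyq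
      exact ⟨i, hi, fun h => hiq (hpq.idx_subset h), hyi⟩

theorem exists_upper_bound (hB : LocallyFinite B) {c : Set (PartialExtension A f B W)}
    (hc : IsChain Extends c) (hne : c.Nonempty) :
    ∃ ub : PartialExtension A f B W, ∀ p ∈ c, p.Extends ub := by
  classical
  have total : ∀ p ∈ c, ∀ q ∈ c, p.Extends q ∨ q.Extends p := fun p hp q hq => by
    by_cases h : p = q
    · exact Or.inl (h ▸ Extends.refl p)
    · exact hc hp hq h
  obtain ⟨p₀, hp₀⟩ := hne
  let D : Set Y := ⋃ p ∈ c, p.dom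
  let S : Set ι := ⋃ p ∈ c, p.idx
  have hD : ∀ {y}, y ∈ D ↔ ∃ p ∈ c, y ∈ p.dom := by simp [D]
  have agree : ∀ p ∈ c, ∀ q ∈ c, ∀ y ∈ p.dom, y ∈ q.dom → p.toFun y = q.toFun y := by
    intro p hp q hq y hyp hyq
    rcases total p hp q hq with h | h
    · exact (h.eqOn hyp).symm
    · exact h.eqOn hyq
  let F : Y → Z := fun y => if h : ∃ p ∈ c, y ∈ p.dom then h.choose.toFun y else p₀.toFun y
  have hF : ∀ p ∈ c, EqOn F p.toFun p.dom := by
    intro p hp y hy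
    have h : ∃ p ∈ c, y ∈ p.dom := ⟨p, hp, hy⟩
    simp only [F, h, dite_true]
    exact agree _ h.choose_spec.1 _ hp _ h.choose_spec.2 hy
  -- Near `y`, the union of the domains is the domain of any member of the chain that has taken
  -- care of the finitely many relevant indices.
  have loc : ∀ y, ∃ N ∈ 𝓝 y, ∃ p ∈ c, D ∩ N ⊆ p.dom := by
    intro y
    obtain ⟨N, hN, hfin⟩ := hB y
    have hfin' := hfin.inter_of_left S
    obtain ⟨p, hp, hpS⟩ := DirectedOn.exists_mem_subset_of_finset_subset_biUnion
      (f := fun p : PartialExtension A f B W => p.idx) (s := hfin'.toFinset) ⟨p₀, hp₀⟩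
      (fun p hp q hq => (total p hp q hq).elim
        (fun h => ⟨q, hq, h.idx_subset, Subset.rfl⟩) (fun h => ⟨p, hp, Subset.rfl, h.idx_subset⟩))
      (by rw [hfin'.coe_toFinset]; exact inter_subset_right)
    rw [hfin'.coe_toFinset] at hpS
    refine ⟨N, hN, p, hp, ?_⟩
    rintro z ⟨hzD, hzN⟩
    obtain ⟨q, hq, hzq⟩ := hD.1 hzD
    by_contra hzp
    rcases total p hp q hq with h | h
    · obtain ⟨i, hi, hip, hzi⟩ := h.exists_mem z hzq hzp
      exact hip (hpS ⟨⟨z, hzi, hzN⟩, mem_biUnion hq hi⟩)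
    · exact hzp (h.dom_subset hzq)
  have hpD : ∀ p ∈ c, p.dom ⊆ D := fun p hp => subset_biUnion_of_mem (u := fun p => p.dom) hp
  refine ⟨⟨S, D, F, ?_, p₀.subset_dom.trans (hpD p₀ hp₀), ?_, ?_, ?_, ?_⟩,
    fun p hp => ⟨?_, hpD p hp, hF p hp, ?_⟩⟩
  · refine isClosed_of_closure_subset fun y hy => ?_
    obtain ⟨N, hN, p, hp, hDN⟩ := loc y
    refine hpD p hp (p.isClosed_dom.closure_subset ?_)
    rw [mem_closure_iff_nhdsWithin_neBot] at hy ⊢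
    rw [← nhdsWithin_inter_of_mem' (mem_nhdsWithin_of_mem_nhds hN)] at hy
    exact hy.mono (nhdsWithin_mono _ hDN)
  · exact fun a ha => (hF p₀ hp₀ (p₀.subset_dom ha)).trans (p₀.eqOn ha)
  · intro y hy
    obtain ⟨N, hN, p, hp, hDN⟩ := loc y
    have hyp : y ∈ p.dom := hDN ⟨hy, mem_of_mem_nhds hN⟩
    exact (continuousWithinAt_inter hN).1
      (((p.continuousOn y hyp).congr (hF p hp) (hF p hp hyp)).mono hDN)
  · rintro i y ⟨hy, hyi⟩
    obtain ⟨p, hp, hyp⟩ := hD.1 hy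
    rw [hF p hp hyp]
    exact p.mapsTo i ⟨hyp, hyi⟩
  · intro i hi a ha
    obtain ⟨p, hp, hip⟩ := mem_iUnion₂.1 hi
    exact mem_of_superset (p.mem_nhdsWithin i hip a ha) (hpD p hp)
  · exact subset_biUnion_of_mem (u := fun p => p.idx) hp
  · intro y hy hyp
    obtain ⟨q, hq, hyq⟩ := hD.1 hy
    rcases total p hp q hq with h | h
    · obtain ⟨i, hi, hip, hyi⟩ := h.exists_mem y hyq hyp
      exact ⟨i, mem_biUnion hq hi, hip, hyi⟩
    · exact absurd (h.dom_subset hyq) hyp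

/-- One more index can be treated, provided maps from closed sets into `W i` have neighborhood
extensions. -/
theorem exists_insert [NormalSpace Y] (hB : LocallyFinite B) (hBc : ∀ i, IsClosed (B i))
    (hW : ∀ i, IsOpen (W i)) {i : ι}
    (hext : ∀ (K : Set Y) (g : Y → Z), IsClosed K → ContinuousOn g K → MapsTo g K (W i) →
      ∃ U : Set Y, IsOpen U ∧ K ⊆ U ∧ ∃ F : Y → Z, ContinuousOn F U ∧ EqOn F g K)
    (p : PartialExtension A f B W) (hi : i ∉ p.idx) :
    ∃ q : PartialExtension A f B W, p.Extends q ∧ i ∈ q.idx := by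
  classical
  have hK : IsClosed (p.dom ∩ B i) := p.isClosed_dom.inter (hBc i)
  obtain ⟨U, hU, hKU, F, hFc, hF⟩ := hext (p.dom ∩ B i) p.toFun hK
    (p.continuousOn.mono inter_subset_left) (p.mapsTo i)
  -- The part of `U` where the condition on every `B j` holds is open, since its complement is a
  -- locally finite union of closed sets.
  let O : Set Y := {y | y ∈ U ∧ ∀ j, y ∈ B j → F y ∈ W j}
  have hO : IsOpen O := by
    have hV : ∀ j, IsOpen (U ∩ F ⁻¹' W j) := fun j => hFc.isOpen_inter_preimage hU (hW j)
    have hcl : IsClosed (⋃ j, B j ∩ (U ∩ F ⁻¹' W j)ᶜ) :=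
      (hB.subset fun j => inter_subset_left).isClosed_iUnion
        fun j => (hBc j).inter (hV j).isClosed_compl
    have : O = U ∩ (⋃ j, B j ∩ (U ∩ F ⁻¹' W j)ᶜ)ᶜ := by
      ext y
      simp only [O, mem_ofPred_eq, mem_inter_iff, mem_compl_iff, mem_iUnion, mem_preimage]
      grind
    rw [this]
    exact hU.inter hcl.isOpen_compl
  have hKO : p.dom ∩ B i ⊆ O := fun y hy =>
    ⟨hKU hy, fun j hj => by rw [hF hy]; exact p.mapsTo j ⟨hy.1, hj⟩⟩
  obtain ⟨V, hVo, hKV, hVO⟩ := normal_exists_closure_subset hK hO hKO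
  let C : Set Y := B i ∩ closure V
  have hCO : C ⊆ O := inter_subset_right.trans hVO
  let F' : Y → Z := p.dom.piecewise p.toFun F
  have hF'D : EqOn F' p.toFun p.dom := piecewise_eqOn _ _ _
  have hF'C : EqOn F' F C := by
    intro y hy
    by_cases hyD : y ∈ p.dom
    · rw [hF'D hyD, hF ⟨hyD, hy.1⟩]
    · exact piecewise_eq_of_notMem _ _ _ hyD
  have hC : IsClosed C := (hBc i).inter isClosed_closure
  refine ⟨⟨insert i p.idx, p.dom ∪ C, F', p.isClosed_dom.union hC,
    p.subset_dom.trans subset_union_left, fun a ha => (hF'D (p.subset_dom ha)).trans (p.eqOn ha),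
    ?_, ?_, ?_⟩, ⟨subset_insert _ _, subset_union_left, hF'D, ?_⟩, mem_insert _ _⟩
  · exact (p.continuousOn.congr hF'D).union_of_isClosed
      ((hFc.mono fun y hy => (hCO hy).1).congr hF'C) p.isClosed_dom hC
  · rintro j y ⟨hy | hy, hyj⟩
    · rw [hF'D hy]
      exact p.mapsTo j ⟨hy, hyj⟩
    · rw [hF'C hy]
      exact (hCO hy).2 j hyj
  · rintro j (rfl | hj) a ha
    · have hVa : V ∈ 𝓝 a := hVo.mem_nhds (hKV ⟨p.subset_dom ha.1, ha.2⟩)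
      filter_upwards [self_mem_nhdsWithin, mem_nhdsWithin_of_mem_nhds hVa] with y hyB hyV
      exact Or.inr ⟨hyB, subset_closure hyV⟩
    · exact mem_of_superset (p.mem_nhdsWithin j hj a ha) subset_union_left
  · rintro y (hy | hy) hyp
    · exact absurd hy hyp
    · exact ⟨i, mem_insert _ _, hi, hy.1⟩

end PartialExtension

/-! ### Spaces covered by open ANEs -/

/-- Hanner's theorem: a metrizable space that is locally an ANE is an ANE. -/
theorem isANE_of_isOpenEmbedding_cover {ι Z : Type*} {X : ι → Type*} [TopologicalSpace Z]
    [MetrizableSpace Z] [∀ i, TopologicalSpace (X i)] (hX : ∀ i, IsANE.{w} (X i))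
    (e : ∀ i, X i → Z) (he : ∀ i, IsOpenEmbedding (e i)) (hcover : ∀ z, ∃ i, z ∈ range (e i)) :
    IsANE.{w} Z := by
  classical
  refine ⟨inferInstance, fun Y _ _ A hA f => ?_⟩
  obtain hemp | ⟨⟨a₀, ha₀⟩⟩ := A.eq_empty_or_nonempty
  · subst hemp
    exact ⟨∅, isOpen_empty, Subset.rfl, ⟨fun y => y.2.elim, continuous_of_const fun y => y.2.elim⟩,
      fun a => a.2.elim⟩
  let f' : Y → Z := fun y => if h : y ∈ A then f ⟨y, h⟩ else f ⟨a₀, ha₀⟩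
  have hff' : ∀ a : A, f' a = f a := fun a => by simp [f']
  have hf' : ContinuousOn f' A := by
    rw [continuousOn_iff_continuous_domRestrict]
    have : A.domRestrict f' = f := funext hff'
    rw [this]
    exact f.continuous
  have := fun i => continuousOn_iff'.1 hf' _ (he i).isOpen_range
  choose V hVo hV using this
  have hAV : A ⊆ ⋃ i, V i := by
    intro a ha
    obtain ⟨i, hi⟩ := hcover (f' a)
    have : a ∈ f' ⁻¹' range (e i) ∩ A := ⟨hi, ha⟩
    rw [hV i] at this
    exact mem_iUnion.2 ⟨i, this.1⟩
  let := metrizableSpaceMetric Y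
  obtain ⟨v, hvo, hAv, hvf, hvV⟩ := precise_refinement_set hA V hVo hAV
  obtain ⟨v', hAv', hv'o, hv'v⟩ :=
    exists_subset_iUnion_closure_subset hA hvo (fun y _ => hvf.point_finite y) hAv
  have hB : LocallyFinite fun i => closure (v' i) := hvf.subset hv'v
  let base : PartialExtension A f' (fun i => closure (v' i)) (fun i => range (e i)) :=
    { idx := ∅
      dom := A
      toFun := f'
      isClosed_dom := hA
      subset_dom := Subset.rfl
      eqOn := fun _ _ => rfl
      continuousOn := hf'
      mapsTo := by
        rintro i a ⟨ha, hai⟩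
        have : a ∈ V i ∩ A := ⟨hvV i (hv'v i hai), ha⟩
        rw [← hV i] at this
        exact this.1
      mem_nhdsWithin := fun i hi => hi.elim }
  obtain ⟨m, hm⟩ := exists_maximal_of_chains_bounded
    (r := PartialExtension.Extends (A := A) (f := f') (B := fun i => closure (v' i))
      (W := fun i => range (e i)))
    (fun c hc => c.eq_empty_or_nonempty.elim (fun h => ⟨base, by simp [h]⟩)
      (PartialExtension.exists_upper_bound hB hc))
    PartialExtension.Extends.trans
  have hidx : ∀ i, i ∈ m.idx := by
    intro i
    by_contra hi
    obtain ⟨q, hmq, hiq⟩ := PartialExtension.exists_insert hB (fun _ => isClosed_closure)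
      (fun j => (he j).isOpen_range)
      (fun K g hK hg hgK => (hX i).exists_continuousOn_extension (he i).isEmbedding hK hg hgK) m hi
    exact hi ((hm q hmq).idx_subset hiq)
  have hmA : A ⊆ interior m.dom := by
    intro a ha
    rw [mem_interior_iff_mem_nhds]
    have hnhds : (⋃ i, closure (v' i)) ∈ 𝓝 a :=
      mem_of_superset ((isOpen_iUnion hv'o).mem_nhds (hAv' ha))
        (iUnion_mono fun i => subset_closure)
    rw [← nhdsWithin_eq_nhds.2 hnhds, hB.nhdsWithin_iUnion, mem_iSup]
    intro i
    by_cases hai : a ∈ closure (v' i)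
    · exact m.mem_nhdsWithin i (hidx i) a ⟨ha, hai⟩
    · have : 𝓝[closure (v' i)] a = ⊥ := by
        rwa [← not_neBot, ← mem_closure_iff_nhdsWithin_neBot, closure_closure]
      rw [this]
      exact mem_bot
  exact ⟨interior m.dom, isOpen_interior, hmA,
    ⟨_, (m.continuousOn.mono interior_subset).domRestrict⟩, fun a => (m.eqOn a.2).trans (hff' a)⟩

/-! ### The translates of `X` in the enveloping space -/

namespace PartialAction

variable {G : Type u} {X : Type v} [Group G]

/-- The map `x ↦ [(g, x)]`, whose image is the translate by `g` of the copy of `X` in `X_G`. -/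
def translate (θ : PartialAction G X) (g : G) (x : X) : θ.EnvelopingSpace :=
  Quotient.mk θ.envelopingSetoid (g, x)

theorem exists_mem_range_translate (θ : PartialAction G X) (z : θ.EnvelopingSpace) :
    ∃ g, z ∈ range (θ.translate g) := by
  induction z using Quotient.inductionOn with
  | h p => exact ⟨p.1, p.2, rfl⟩

theorem translate_injective (θ : PartialAction G X) (g : G) :
    Function.Injective (θ.translate g) := by
  intro x y hxy
  obtain ⟨hx, h⟩ : θ.Rel (g, x) (g, y) := Quotient.exact hxy
  obtain ⟨h1, h1x⟩ := θ.one_act x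
  simp only [inv_mul_cancel] at hx h
  exact h1x.symm.trans h

variable [TopologicalSpace G] [TopologicalSpace X]

theorem IsNice.isOpenEmbedding_translate [IsTopologicalGroup G] {θ : PartialAction G X}
    (hθ : θ.IsNice) (g : G) : IsOpenEmbedding (θ.translate g) := by
  have hq : IsQuotientMap (fun p : G × X => θ.translate p.1 p.2) := isQuotientMap_quotient_mk'
  refine .of_continuous_injective_isOpenMap
    (hq.continuous.comp (Continuous.prodMk_right g))
    (θ.translate_injective g) fun U hU => hq.isOpen_preimage.1 ?_
  have hpre : (fun p : G × X => θ.translate p.1 p.2) ⁻¹' (θ.translate g '' U) =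
      (fun q : G × X => (g⁻¹ * q.1, q.2)) ⁻¹' (Subtype.val '' (θ.act ⁻¹' U)) := by
    ext ⟨h, y⟩
    constructor
    · rintro ⟨x, hx, hxy⟩
      obtain ⟨hy, hyx⟩ : θ.Rel (h, y) (g, x) := Quotient.exact hxy.symm
      exact ⟨⟨_, hy⟩, (congrArg (· ∈ U) hyx).mpr hx, rfl⟩
    · rintro ⟨⟨_, hy⟩, hU, rfl⟩
      exact ⟨_, hU, Quotient.sound (θ.rel_equivalence.symm ⟨hy, rfl⟩)⟩
  rw [hpre]
  exact (hθ.isOpen_dom.isOpenMap_subtype_val _ (hU.preimage hθ.continuous_act)).preimage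
    (by fun_prop)

end PartialAction

theorem mainTheorem9 {G : Type u} [Group G] [TopologicalSpace G] [IsTopologicalGroup G] [T2Space G]
    {X : Type v} [TopologicalSpace X] [MetrizableSpace X] [SeparableSpace X]
    (θ : PartialAction G X) (hθ : θ.IsNice) (hXG : MetrizableSpace θ.EnvelopingSpace) :
    IsANE.{w} X ↔ IsANE.{w} θ.EnvelopingSpace := by
  constructor
  · intro hX
    exact isANE_of_isOpenEmbedding_cover (fun _ : G => hX) θ.translate
      hθ.isOpenEmbedding_translate θ.exists_mem_range_translate
  · exact fun hXG => hXG.of_isOpenEmbedding (hθ.isOpenEmbedding_translate 1)
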